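/- \textbf{Setting.} Let $M$ be a tabular episodic MDP with finite state space $\mathcal S$ ($S=|\mathcal S|$), finite action space $\mathcal A$ ($A=|\mathcal A|$), horizon $H$, an initial state distribution, and transition kernels $P_h(s'\mid s,a)$, $h\in[H]$. An episode is a trajectory $(s_1,a_1,\dots,s_H,a_H,s_{H+1})$; policies are deterministic and step-dependent, and $V^\pi(r,P)=\mathbb E_{P,\pi}\big[\sum_{h=1}^H r_h(s_h,a_h)\big]$. Let $\delta\in(0,1)$, let $E_\varepsilon\ge 1$, let $T_1,\dots,T_K\ge 1$ be stage lengths with $\sum_k T_k\le T$, and put $\iota=\log(2SAHT/\delta)$. \textbf{Private crude exploration.} At the start of each stage $k=1,\dots,K$ an algorithm has an active policy set $\Pi_k$, determined by the information gathered so far. For each $h=1,\dots,H$ in turn it picks, for every $(s,a)$, a policy $\pi^{\mathrm{cru}}_{h,s,a}\in\arg\max_{\pi\in\Pi_k}V^\pi(1_{h,s,a},\hat P)$, where $\hat P=\hat P^{\mathrm{cru},k}$ is the crude estimate below and $1_{h,s,a}$ is the reward that equals $1$ at $(s,a)$ at step $h$ and $0$ otherwise, so that only the layers of $\hat P$ before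 $h$ matter. It then runs $\lfloor T_k/H\rfloor$ episodes; given the past these are independent, and each follows a policy drawn uniformly from $\{\pi^{\mathrm{cru}}_{h,s,a}\}_{(s,a)\in\mathcal S\times\mathcal A}$. From the true counts $N_h(s,a)$, $N_h(s,a,s')$ of visits at step $h$ in this batch, a privatizer releases private counts $\tilde N_h(s,a)$, $\tilde N_h(s,a,s')$. Set $$\mathcal F_k=\{(h,s,a,s'):\tilde N_h(s,a,s')\le 6E_\varepsilon H^2\iota\},$$ add an absorbing state $s_\dagger$ with zero reward, and let $\hat P_h(s'\mid s,a)=\tilde N_h(s,a,s')/\tilde N_h(s,a)$ if $(h,s,a,s')\notin\mathcal F_k$ and $0$ otherwise, with the remaining mass put on $s_\dagger$. \textbf{Absorbing MDP.} $\tilde P=\tilde P^{k}$ is the kernel on $\mathcal S\cup\{s_\dagger\}$ with $\tilde P_h(s'\mid s,a)=P_h(s'\mid s,a)$ for $(h,s,a,s')\notin\mathcal F_k$, $\tilde P_h(s'\mid s,a)=0$ for $(h,s,a,s')\in\mathcal F_k$, $\tilde P_h(s_\dagger\mid s,a)=\sum_{s':(h,s,a,s')\in\mathcal F_k}P_h(s'\mid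 s,a)$ and $\tilde P_h(s_\dagger\mid s_\dagger,a)=1$. \textbf{Private counts.} Assume that with probability at least $1-3\delta$, simultaneously for all $k,h,s,a,s'$, $$N_h(s,a)\le\tilde N_h(s,a)\le N_h(s,a)+E_\varepsilon,\qquad |\tilde N_h(s,a,s')-N_h(s,a,s')|\le E_\varepsilon .$$ \textbf{Claim.} There is a universal constant $C>0$ such that in every such setting, with probability at least $1-7\delta$, for every stage $k$, every $\pi\in\Pi_k$ and every reward function $r'$ with $r'_h(s,a)\in[0,1]$, $$0\;\le\;V^\pi(r',P)-V^\pi(r',\tilde P)\;\le\;C\,\frac{E_\varepsilon S^3AH^5\iota}{T_k}.$$ -/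

import Mathlib

open MeasureTheory ProbabilityTheory

noncomputable section

namespace PrivateRL

/-- A tabular episodic Markov decision process with horizon `H`: an initial distribution and
step-dependent transition probabilities `trans h s a s' = P_h(s' | s, a)`.  (Rewards are kept
separate, since values are considered for arbitrary rewards.) -/
structure EpisodicMDP (S A : Type*) [Fintype S] (H : ℕ) where
  init : S → ℝ
  init_nonneg : ∀ s, 0 ≤ init s
  init_sum : ∑ s, init s = 1
  trans : Fin H → S → A → S → ℝ
  trans_nonneg : ∀ h s a s', 0 ≤ trans h s a s'
  trans_sum : ∀ h s a, ∑ s', trans h s a s' = 1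

/-- Deterministic step-dependent policies. -/
abbrev Policy (S A : Type*) (H : ℕ) : Type _ := Fin H → S → A

/-- Trajectories `(s_1, a_1, …, s_H, a_H, s_{H+1})`: states and actions. -/
abbrev Traj (X A : Type*) (H : ℕ) : Type _ := (Fin (H + 1) → X) × (Fin H → A)

open Classical in
/-- Probability of a trajectory under initial distribution `ν`, transitions `P` and policy `π`. -/
def trajProb {X A : Type*} {H : ℕ} (ν : X → ℝ) (P : Fin H → X → A → X → ℝ)
    (π : Policy X A H) (τ : Traj X A H) : ℝ :=
  ν (τ.1 0) * ∏ h : Fin H,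
    if τ.2 h = π h (τ.1 h.castSucc) then P h (τ.1 h.castSucc) (τ.2 h) (τ.1 h.succ) else 0

open Classical in
/-- The value `V^π(r, P)`: the expected total reward, `E_{P,π}[∑_h r_h(s_h, a_h)]`. -/
def value {X A : Type*} [Fintype X] [Fintype A] {H : ℕ} (ν : X → ℝ)
    (P : Fin H → X → A → X → ℝ) (π : Policy X A H) (r : Fin H → X → A → ℝ) : ℝ :=
  ∑ τ : Traj X A H, trajProb ν P π τ * ∑ h : Fin H, r h (τ.1 h.castSucc) (τ.2 h)

/-- `V^π(r, Q)` for a kernel `Q` on the state space `Option S`, which is `S` with an additional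
absorbing state `none`.  The initial distribution does not charge `none`, the reward in `none`
is zero, and the action played in `none` is an arbitrary fixed one. -/
def valueExt {S A : Type*} [Fintype S] [Fintype A] [Nonempty A] {H : ℕ} (ν : S → ℝ)
    (Q : Fin H → Option S → A → Option S → ℝ) (π : Policy S A H) (r : Fin H → S → A → ℝ) : ℝ :=
  value (fun x => x.elim 0 ν) Q (fun h x => x.elim (Classical.arbitrary A) (π h))
    (fun h x a => x.elim 0 (fun s => r h s a))

open Classical in
/-- The reward function `1_{h,s,a}`. -/
def indicatorReward {S A : Type*} {H : ℕ} (h : Fin H) (s : S) (a : A) : Fin H → S → A → ℝ :=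
  fun h' s' a' => if h' = h ∧ s' = s ∧ a' = a then 1 else 0

open Classical in
/-- The absorbing transition kernel `P̃`: transitions along the tuples in `F` are redirected to the
absorbing state `none`; all other transitions agree with `P`. -/
def absorbingKernel {S A : Type*} [Fintype S] {H : ℕ} (P : Fin H → S → A → S → ℝ)
    (F : Set (Fin H × S × A × S)) : Fin H → Option S → A → Option S → ℝ
  | h, some s, a, some s' => if (h, s, a, s') ∈ F then 0 else P h s a s'
  | h, some s, a, none => ∑ s' : S, if (h, s, a, s') ∈ F then P h s a s' else 0
  | _, none, _, some _ => 0
  | _, none, _, none => 1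

open Classical in
/-- The crude transition estimate built from counts `n2 h s a` of state-action pairs and
`n3 h s a s'` of transitions: the ratio of counts outside `F`, zero on `F`, and the
remaining mass on the absorbing state. -/
def crudeKernel {S A : Type*} [Fintype S] {H : ℕ} (n2 : Fin H → S → A → ℝ)
    (n3 : Fin H → S → A → S → ℝ) (F : Set (Fin H × S × A × S)) :
    Fin H → Option S → A → Option S → ℝ
  | h, some s, a, some s' => if (h, s, a, s') ∈ F then 0 else n3 h s a s' / n2 h s a
  | h, some s, a, none =>
      1 - ∑ s' : S, if (h, s, a, s') ∈ F then 0 else n3 h s a s' / n2 h s a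
  | _, none, _, some _ => 0
  | _, none, _, none => 1

/-- The infrequently visited tuples: those whose (private) count is at most `C₁ E H² ι`
with `C₁ = 6`. -/
def infrequent {S A : Type*} {H : ℕ} (E ι : ℝ) (n3 : Fin H → S → A → S → ℝ) :
    Set (Fin H × S × A × S) :=
  {x | n3 x.1 x.2.1 x.2.2.1 x.2.2.2 ≤ 6 * E * (H : ℝ) ^ 2 * ι}

open Classical in
/-- Number of visits to `(s, a)` at step `h` in a dataset of `n` trajectories. -/
def visits {S A : Type*} {H n : ℕ} (D : Fin n → Traj S A H) (h : Fin H) (s : S) (a : A) : ℕ :=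
  (Finset.univ.filter fun i => (D i).1 h.castSucc = s ∧ (D i).2 h = a).card

open Classical in
/-- Number of transitions from `(s, a)` to `s'` at step `h` in a dataset of `n` trajectories. -/
def visitsNext {S A : Type*} {H n : ℕ} (D : Fin n → Traj S A H) (h : Fin H) (s : S) (a : A)
    (s' : S) : ℕ :=
  (Finset.univ.filter fun i =>
    (D i).1 h.castSucc = s ∧ (D i).2 h = a ∧ (D i).1 h.succ = s').card

/-- Probability of a trajectory when the policy is drawn uniformly among `(pol s a)_{s,a}` at the
start of the episode. -/
def mixtureProb {S A : Type*} [Fintype S] [Fintype A] {H : ℕ} (M : EpisodicMDP S A H)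
    (pol : S → A → Policy S A H) (τ : Traj S A H) : ℝ :=
  (1 / ((Fintype.card S : ℝ) * (Fintype.card A : ℝ))) *
    ∑ s : S, ∑ a : A, trajProb M.init M.trans (pol s a) τ

/-- The logarithmic factor `ι = log (2 S A H T / δ)`. -/
def logFactor (S A : Type*) [Fintype S] [Fintype A] (H T : ℕ) (δ : ℝ) : ℝ :=
  Real.log (2 * (Fintype.card S : ℝ) * (Fintype.card A : ℝ) * (H : ℝ) * (T : ℝ) / δ)

/-- A run, on the probability space `(Ω, μ)`, of a private policy elimination algorithm in the
MDP `M`, with `K` stages of lengths `len k`, private-count error `E` and logarithmic factor `ι`.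
Layer `h` of the crude exploration of stage `k` is batch number `k H + h` (counting from zero).
`hist t` is all the information available before batch `t`; besides earlier batches it may
contain anything else that happened before, such as observed rewards and the fine
exploration of earlier stages. -/
structure Run {S A Ω : Type*} [Fintype S] [Fintype A] [Nonempty A] {H : ℕ}
    (M : EpisodicMDP S A H) [mΩ : MeasurableSpace Ω] (μ : Measure Ω)
    {K : ℕ} (len : Fin K → ℕ) (E ι : ℝ) where
  hist : Filtration ℕ mΩ
  /-- the set `Π_k` of active policies of stage `k` -/
  active : Fin K → Ω → Set (Policy S A H)
  /-- the policies `π^{cru}_{h,s,a}` of stage `k` -/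
  pol : Fin K → Fin H → Ω → S → A → Policy S A H
  /-- the `⌊len k / H⌋` trajectories collected in layer `h` of stage `k` -/
  data : (k : Fin K) → Fin H → Ω → Fin (len k / H) → Traj S A H
  /-- private version of the number of visits to `(h, s, a)` in layer `h` of stage `k` -/
  priv2 : Fin K → Ω → Fin H → S → A → ℝ
  /-- private version of the number of visits to `(h, s, a, s')` in layer `h` of stage `k` -/
  priv3 : Fin K → Ω → Fin H → S → A → S → ℝ
  active_measurable : ∀ (k : Fin K) (Z : Set (Policy S A H)),
    MeasurableSet[hist ((k : ℕ) * H)] {ω | active k ω = Z}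
  pol_measurable : ∀ (k : Fin K) (h : Fin H) (p : S → A → Policy S A H),
    MeasurableSet[hist ((k : ℕ) * H + h)] {ω | pol k h ω = p}
  data_measurable : ∀ (k : Fin K) (h : Fin H) (d : Fin (len k / H) → Traj S A H),
    MeasurableSet[hist ((k : ℕ) * H + h + 1)] {ω | data k h ω = d}
  priv2_measurable : ∀ (k : Fin K) (h : Fin H) (s : S) (a : A),
    Measurable[hist ((k : ℕ) * H + h + 1)] (fun ω => priv2 k ω h s a)
  priv3_measurable : ∀ (k : Fin K) (h : Fin H) (s : S) (a : A) (s' : S),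
    Measurable[hist ((k : ℕ) * H + h + 1)] (fun ω => priv3 k ω h s a s')
  /-- `π^{cru}_{h,s,a}` is an active policy that maximizes the probability of visiting
  `(s, a)` at step `h` under the crude estimate.  This value involves only the steps before
  `h` of the estimate, which are known before layer `h` is run. -/
  pol_argmax : ∀ (k : Fin K) (h : Fin H) (ω : Ω) (s : S) (a : A),
    IsMaxOn
      (fun π => valueExt M.init
        (crudeKernel (priv2 k ω) (priv3 k ω) (infrequent E ι (priv3 k ω))) π
        (indicatorReward h s a))
      (active k ω) (pol k h ω s a) ∧ pol k h ω s a ∈ active k ω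
  /-- Given the past, the trajectories of a layer are independent, and each is generated in `M` by
  a policy drawn uniformly among `(π^{cru}_{h,s,a})_{s,a}`. -/
  data_law : ∀ (k : Fin K) (h : Fin H) (d : Fin (len k / H) → Traj S A H),
    μ⟦{ω | data k h ω = d} | hist ((k : ℕ) * H + h)⟧ =ᵐ[μ]
      fun ω => ∏ i, mixtureProb M (pol k h ω) (d i)

namespace Run

variable {S A Ω : Type*} [Fintype S] [Fintype A] [Nonempty A] {H : ℕ}
  {M : EpisodicMDP S A H} [MeasurableSpace Ω] {μ : Measure Ω}
  {K : ℕ} {len : Fin K → ℕ} {E ι : ℝ}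

/-- The set of infrequently visited tuples of stage `k`. -/
def infreq (R : Run M μ len E ι) (k : Fin K) (ω : Ω) : Set (Fin H × S × A × S) :=
  infrequent E ι (R.priv3 k ω)

/-- The absorbing MDP's transition kernel `P̃` of stage `k`. -/
def absorbing (R : Run M μ len E ι) (k : Fin K) (ω : Ω) :
    Fin H → Option S → A → Option S → ℝ :=
  absorbingKernel M.trans (R.infreq k ω)

/-- The outcome `ω` is one where all private counts have error at most `E`, and the private
state-action counts are optimistic. -/
def CountsAccurate (R : Run M μ len E ι) (ω : Ω) : Prop :=
  ∀ (k : Fin K) (h : Fin H) (s : S) (a : A),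
    ((visits (R.data k h ω) h s a : ℝ) ≤ R.priv2 k ω h s a ∧
      R.priv2 k ω h s a ≤ visits (R.data k h ω) h s a + E) ∧
    ∀ s' : S, |R.priv3 k ω h s a s' - visitsNext (R.data k h ω) h s a s'| ≤ E

end Run

end PrivateRL

end

namespace PrivateRL

/-! Everything is phrased through occupancies: under a deterministic policy a value is the reward
summed against the forward weights `occ` of the induced chain of states. In the absorbing MDP the
weights on real states form a substochastic chain, below the true one. The loss of value is
therefore nonnegative, and it is controlled by the mass that has leaked through removed transitions.
If each removed transition carries at most `B` along the policy, the leak by any step is at most `H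
S² B`, and the total loss at most `H² S² B` (`value_sub_valueExt_absorbing`).

To bound `B`, three facts are combined. (a) A tuple outside the infrequent set has private count
above `6 E H² ι`, so sampling error and privacy noise are both of relative size `1/H`. The crude and
absorbing kernels then agree up to a factor `1 + 5/H` in both directions (`private_ratio_close`),
and occupancies over at most `H` steps agree up to `e⁵`. (b) The exploration policy for `(h, s, a)`
maximizes the crude occupancy among active policies. Passing from the absorbing to the crude kernel,
to the maximizer, and back costs `e¹⁰`, and the absorbing occupancy of the maximizer is at most its
true one (`occ_absorbing_le_explore`). The uniform mixture plays this maximizer with probability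
`1/(SA)`. (c) A transition declared infrequent has a small count in a batch of about `T_k/H`
episodes, so its probability under the mixture is at most `40 E H³ ι / T_k`
(`mixtureNext_le_of_mem_infreq`). Thus `B = e¹⁰ · SA · 40 E H³ ι / T_k`, which yields the claimed
rate.

The probabilistic input is exponential Markov for three tilted sums per tuple (`Concentrated`), each
failing with probability at most `exp (-2ι)`. A union bound over all stages, steps and tuples costs
at most `4δ`, to which the `3δ` of the private counts is added. -/

/-- The weight of a path of states under initial weights `ν` and step kernels `Q`. -/
noncomputable def pathWeight {X : Type*} {H : ℕ} (ν : X → ℝ) (Q : Fin H → X → X → ℝ)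
    (x : Fin (H + 1) → X) : ℝ :=
  ν (x 0) * ∏ h : Fin H, Q h (x h.castSucc) (x h.succ)

/-- The forward occupancy weights of a (not necessarily stochastic) chain. -/
noncomputable def occ {X : Type*} [Fintype X] {H : ℕ} (ν : X → ℝ) (q : Fin H → X → X → ℝ) :
    ℕ → X → ℝ
  | 0 => ν
  | n + 1 => fun v => if h : n < H then ∑ u, occ ν q n u * q ⟨n, h⟩ u v else 0

/-- The chain of states obtained by following `π` in `P`. -/
def polKernel {X A : Type*} {H : ℕ} (P : Fin H → X → A → X → ℝ) (π : Policy X A H) :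
    Fin H → X → X → ℝ :=
  fun h u v => P h u (π h u) v

/-! ### Trajectory sums as forward occupancies -/

section Paths

variable {X A : Type*} [Fintype X] {H : ℕ}

/-- A deterministic policy leaves one action sequence of nonzero weight for each path of states. -/
theorem sum_trajProb_mul [Fintype A] (ν : X → ℝ) (P : Fin H → X → A → X → ℝ)
    (π : Policy X A H) (f : Traj X A H → ℝ) :
    ∑ τ, trajProb ν P π τ * f τ =
      ∑ x, pathWeight ν (polKernel P π) x * f (x, fun h => π h (x h.castSucc)) := by
  classical
  rw [Fintype.sum_prod_type]
  refine Finset.sum_congr rfl fun x _ => ?_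
  rw [Finset.sum_eq_single (fun h => π h (x h.castSucc))]
  · simp [trajProb, pathWeight, polKernel]
  · intro b _ hb
    obtain ⟨h, hh⟩ := Function.ne_iff.1 hb
    have : trajProb ν P π (x, b) = 0 := by
      unfold trajProb
      rw [Finset.prod_eq_zero (Finset.mem_univ h), mul_zero]
      simp [hh]
    rw [this, zero_mul]
  · simp

theorem sum_pathWeight_snoc (ν : X → ℝ) (Q : Fin (H + 1) → X → X → ℝ)
    (f : (Fin (H + 2) → X) → ℝ) :
    ∑ x, pathWeight ν Q x * f x =
      ∑ x : Fin (H + 1) → X, pathWeight ν (fun h => Q h.castSucc) x *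
        ∑ y, Q (Fin.last H) (x (Fin.last H)) y * f (Fin.snoc (α := fun _ => X) x y) := by
  rw [← (Fin.snocEquiv (fun _ : Fin (H + 2) => X)).sum_comp, Fintype.sum_prod_type,
    Finset.sum_comm]
  refine Finset.sum_congr rfl fun x _ => ?_
  rw [Finset.mul_sum]
  refine Finset.sum_congr rfl fun y _ => ?_
  have h0 : (Fin.snoc (α := fun _ => X) x y : Fin (H + 2) → X) 0 = x 0 := by
    rw [← Fin.castSucc_zero, Fin.snoc_castSucc]
  have h1 : pathWeight ν Q (Fin.snoc (α := fun _ => X) x y) =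
      pathWeight ν (fun h => Q h.castSucc) x * Q (Fin.last H) (x (Fin.last H)) y := by
    unfold pathWeight
    rw [Fin.prod_univ_castSucc, h0]
    simp only [Fin.snoc_castSucc, Fin.succ_last, Fin.snoc_last, ← Fin.castSucc_succ, mul_assoc]
  change pathWeight ν Q (Fin.snoc (α := fun _ => X) x y) * f _ = _
  rw [h1, mul_assoc]
  rfl

theorem occ_castSucc (ν : X → ℝ) (Q : Fin (H + 1) → X → X → ℝ) (n : ℕ) (hn : n ≤ H) :
    occ ν (fun h : Fin H => Q h.castSucc) n = occ ν Q n := by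
  induction n with
  | zero => rfl
  | succ n ih =>
    funext v
    have h1 : n < H := hn
    have h2 : n < H + 1 := by omega
    simp only [occ, h1, h2, dif_pos, ih h1.le]
    rfl

theorem sum_pathWeight_last (ν : X → ℝ) (Q : Fin H → X → X → ℝ) (g : X → ℝ) :
    ∑ x, pathWeight ν Q x * g (x (Fin.last H)) = ∑ u, occ ν Q H u * g u := by
  induction H generalizing g with
  | zero =>
    rw [← (Equiv.funUnique (Fin 1) X).symm.sum_comp]
    simp [pathWeight, occ]
  | succ H ih =>
    rw [sum_pathWeight_snoc]
    simp only [Fin.snoc_last]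
    rw [ih (fun h => Q h.castSucc) (fun u => ∑ y, Q (Fin.last H) u y * g y),
      occ_castSucc _ _ _ le_rfl]
    have h2 : H < H + 1 := by omega
    simp only [occ, h2, dif_pos, Finset.sum_mul, Finset.mul_sum]
    rw [Finset.sum_comm]
    refine Finset.sum_congr rfl fun y _ => Finset.sum_congr rfl fun u _ => ?_
    rw [mul_assoc]
    rfl

/-- Steps after `h` are summed out from the end, each contributing a factor one; this is where the
rows must sum to one. -/
theorem sum_pathWeight_pair (ν : X → ℝ) (Q : Fin H → X → X → ℝ)
    (hQ : ∀ h u, ∑ v, Q h u v = 1) (h : Fin H) (g : X → X → ℝ) :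
    ∑ x, pathWeight ν Q x * g (x h.castSucc) (x h.succ) =
      ∑ u, occ ν Q h u * ∑ v, Q h u v * g u v := by
  induction H with
  | zero => exact h.elim0
  | succ H ih =>
    rw [sum_pathWeight_snoc]
    refine Fin.lastCases ?_ (fun j => ?_) h
    · simp only [Fin.snoc_castSucc, Fin.succ_last, Fin.snoc_last]
      rw [sum_pathWeight_last ν (fun h => Q h.castSucc)
        (fun u => ∑ y, Q (Fin.last H) u y * g u y), occ_castSucc _ _ _ le_rfl]
      rfl
    · simp only [Fin.snoc_castSucc, Fin.succ_castSucc, ← Finset.sum_mul, hQ, one_mul]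
      rw [ih (fun h => Q h.castSucc) (fun h => hQ _) j, occ_castSucc _ _ _ j.2.le]
      rfl

theorem sum_trajProb_pair [Fintype A] (ν : X → ℝ) (P : Fin H → X → A → X → ℝ)
    (hP : ∀ h u a, ∑ v, P h u a v = 1) (π : Policy X A H) (h : Fin H) (g : X → A → X → ℝ) :
    ∑ τ : Traj X A H, trajProb ν P π τ * g (τ.1 h.castSucc) (τ.2 h) (τ.1 h.succ) =
      ∑ u, occ ν (polKernel P π) h u * ∑ v, P h u (π h u) v * g u (π h u) v := by
  rw [sum_trajProb_mul]
  exact sum_pathWeight_pair ν (polKernel P π) (fun h u => hP _ _ _) h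
    (fun u v => g u (π h u) v)

/-- Only row sums are assumed, not nonnegativity: with noisy counts the crude estimate may put
negative mass on the absorbing state, and the formula must still apply to it. -/
theorem value_eq_sum_occ [Fintype A] (ν : X → ℝ) (P : Fin H → X → A → X → ℝ)
    (hP : ∀ h u a, ∑ v, P h u a v = 1) (π : Policy X A H) (r : Fin H → X → A → ℝ) :
    value ν P π r = ∑ h : Fin H, ∑ u, occ ν (polKernel P π) h u * r h u (π h u) := by
  unfold value
  simp only [Finset.mul_sum]
  rw [Finset.sum_comm]
  refine Finset.sum_congr rfl fun h _ => ?_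
  rw [sum_trajProb_pair ν P hP π h (fun u a _ => r h u a)]
  simp only [← Finset.sum_mul, hP, one_mul]

end Paths

/-! ### Substochastic chains and comparison of occupancies -/

section Occ

variable {S A : Type*} [Fintype S] {H : ℕ}

/-- The restriction to `S` of the chain of states obtained by following `π` in a kernel
on `Option S`. -/
def extKernel (Q : Fin H → Option S → A → Option S → ℝ) (π : Policy S A H) :
    Fin H → S → S → ℝ :=
  fun h u v => Q h (some u) (π h u) (some v)

/-- Nothing returns from the absorbing state, so the weights on `S` evolve autonomously. -/
theorem occ_option (ν : S → ℝ) (q : Fin H → Option S → Option S → ℝ)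
    (hq : ∀ h s, q h none (some s) = 0) (n : ℕ) (s : S) :
    occ (fun x : Option S => x.elim 0 ν) q n (some s) =
      occ ν (fun h u v => q h (some u) (some v)) n s := by
  induction n generalizing s with
  | zero => rfl
  | succ n ih =>
    simp only [occ]
    split_ifs with h
    · simp [Fintype.sum_option, hq, ih]
    · rfl

theorem valueExt_eq_sum_occ [Fintype A] [Nonempty A] (ν : S → ℝ)
    (Q : Fin H → Option S → A → Option S → ℝ)
    (hQ : ∀ h x a, ∑ y, Q h x a y = 1) (hn : ∀ h a s, Q h none a (some s) = 0)
    (π : Policy S A H) (r : Fin H → S → A → ℝ) :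
    valueExt ν Q π r = ∑ h : Fin H, ∑ u, occ ν (extKernel Q π) h u * r h u (π h u) := by
  unfold valueExt
  rw [value_eq_sum_occ _ _ hQ]
  refine Finset.sum_congr rfl fun h _ => ?_
  rw [Fintype.sum_option]
  simp only [Option.elim_none, mul_zero, zero_add, Option.elim_some]
  refine Finset.sum_congr rfl fun u _ => ?_
  rw [occ_option _ _ (fun h s => by simp [polKernel, hn])]
  rfl

theorem valueExt_indicatorReward [Fintype A] [Nonempty A] (ν : S → ℝ)
    (Q : Fin H → Option S → A → Option S → ℝ)
    (hQ : ∀ h x a, ∑ y, Q h x a y = 1) (hn : ∀ h a s, Q h none a (some s) = 0)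
    (π : Policy S A H) (h : Fin H) (s : S) (a : A) [Decidable (π h s = a)] :
    valueExt ν Q π (indicatorReward h s a) =
      if π h s = a then occ ν (extKernel Q π) h s else 0 := by
  classical
  rw [valueExt_eq_sum_occ ν Q hQ hn, Finset.sum_eq_single h, Finset.sum_eq_single s]
  · by_cases ha : π h s = a <;> simp [indicatorReward, ha]
  · intro u _ hu; simp [indicatorReward, hu]
  · simp
  · intro j _ hj; simp [indicatorReward, hj]
  · simp

theorem occ_nonneg {ν : S → ℝ} {q : Fin H → S → S → ℝ} (hν : ∀ s, 0 ≤ ν s)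
    (hq : ∀ h u v, 0 ≤ q h u v) (n : ℕ) (s : S) : 0 ≤ occ ν q n s := by
  induction n generalizing s with
  | zero => exact hν s
  | succ n ih =>
    simp only [occ]
    split_ifs
    · exact Finset.sum_nonneg fun u _ => mul_nonneg (ih u) (hq _ _ _)
    · exact le_rfl

/-- A relative error `κ` per step compounds to `κ ^ n`; with `κ = 1 + O(1/H)` this stays bounded up
to the horizon. -/
theorem occ_le_pow_mul_occ {ν : S → ℝ} {q₁ q₂ : Fin H → S → S → ℝ} {κ : ℝ} (hν : ∀ s, 0 ≤ ν s)
    (hq₁ : ∀ h u v, 0 ≤ q₁ h u v) (hκ : 0 ≤ κ)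
    (hle : ∀ h u v, q₁ h u v ≤ κ * q₂ h u v) (hq₂ : ∀ h u v, 0 ≤ q₂ h u v) (n : ℕ) (s : S) :
    occ ν q₁ n s ≤ κ ^ n * occ ν q₂ n s := by
  induction n generalizing s with
  | zero => simp [occ]
  | succ n ih =>
    simp only [occ]
    split_ifs with h
    · rw [Finset.mul_sum]
      refine Finset.sum_le_sum fun u _ => ?_
      calc occ ν q₁ n u * q₁ ⟨n, h⟩ u s
          ≤ (κ ^ n * occ ν q₂ n u) * (κ * q₂ ⟨n, h⟩ u s) :=
            mul_le_mul (ih u) (hle _ _ _) (hq₁ _ _ _)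
              (mul_nonneg (pow_nonneg hκ _) (occ_nonneg hν hq₂ _ _))
        _ = κ ^ (n + 1) * (occ ν q₂ n u * q₂ ⟨n, h⟩ u s) := by ring
    · simp

theorem sum_occ_eq_one {ν : S → ℝ} {q : Fin H → S → S → ℝ} (hν : ∑ s, ν s = 1)
    (hq : ∀ h u, ∑ v, q h u v = 1) (n : ℕ) (hn : n ≤ H) : ∑ s, occ ν q n s = 1 := by
  induction n with
  | zero => exact hν
  | succ n ih =>
    have h : n < H := hn
    simp only [occ, h, dif_pos]
    rw [Finset.sum_comm]
    simp only [← Finset.mul_sum, hq, mul_one]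
    exact ih h.le

/-- The mass a substochastic chain `q ≤ p` has lost by step `n`, compared with the stochastic
chain `p`, is at most the expected one-step losses. -/
theorem sum_occ_sub_occ_le {ν : S → ℝ} {p q : Fin H → S → S → ℝ}
    (hν : ∑ s, ν s = 1) (hp : ∀ h u, ∑ v, p h u v = 1) {L : ℝ}
    (hL : ∀ (h : Fin H), ∑ u, ∑ v, occ ν q h u * (p h u v - q h u v) ≤ L)
    (n : ℕ) (hn : n ≤ H) : ∑ s, (occ ν p n s - occ ν q n s) ≤ n * L := by
  rw [Finset.sum_sub_distrib, sum_occ_eq_one hν hp n hn]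
  induction n with
  | zero => simp [occ, hν]
  | succ n ih =>
    have h : n < H := hn
    have h1 := hL ⟨n, h⟩
    have h2 := ih h.le
    have h3 : ∑ s, occ ν q (n + 1) s = ∑ u, ∑ v, occ ν q n u * q ⟨n, h⟩ u v := by
      simp only [occ, h, dif_pos]
      rw [Finset.sum_comm]
    simp only [mul_sub, Finset.sum_sub_distrib, ← Finset.mul_sum, hp, mul_one] at h1 h3
    rw [h3]
    push_cast
    linarith

end Occ

/-! ### Exponential moment bounds -/

section Chernoff

open Classical in
/-- The exponential Markov inequality for an independent sample of size `n` from finitely many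
weights. -/
theorem sum_prod_le_exp_neg {X : Type*} [Fintype X] (w g : X → ℝ) (hw : ∀ x, 0 ≤ w x)
    (hg : ∑ x, w x * Real.exp (g x) ≤ 1) (n : ℕ) (c : ℝ) :
    ∑ d : Fin n → X, (if c ≤ ∑ i, g (d i) then ∏ i, w (d i) else 0) ≤ Real.exp (-c) := by
  have h1 : ∀ d : Fin n → X, (if c ≤ ∑ i, g (d i) then ∏ i, w (d i) else 0) ≤
      Real.exp (-c) * ∏ i, (w (d i) * Real.exp (g (d i))) := by
    intro d
    have hw' : 0 ≤ ∏ i, w (d i) := Finset.prod_nonneg fun i _ => hw _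
    rw [Finset.prod_mul_distrib, ← Real.exp_sum, mul_left_comm, ← Real.exp_add]
    split_ifs with h
    · refine le_mul_of_one_le_right hw' (Real.one_le_exp ?_)
      linarith
    · positivity
  refine (Finset.sum_le_sum fun d _ => h1 d).trans ?_
  rw [← Finset.mul_sum, ← Fintype.piFinset_univ,
    ← Finset.prod_univ_sum (fun _ => Finset.univ) (fun (_ : Fin n) x => w x * Real.exp (g x))]
  refine mul_le_of_le_one_right (Real.exp_pos _).le ?_
  refine Finset.prod_le_one (fun i _ => ?_) fun i _ => hg
  exact Finset.sum_nonneg fun x _ => mul_nonneg (hw x) (Real.exp_pos _).le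

theorem exp_mgf_bound (p t : ℝ) : (1 + p * (Real.exp t - 1)) * Real.exp (-((Real.exp t - 1) * p)) ≤ 1 := by
  have h := Real.add_one_le_exp ((Real.exp t - 1) * p)
  have h2 : 0 < Real.exp (-((Real.exp t - 1) * p)) := Real.exp_pos _
  calc _ ≤ Real.exp ((Real.exp t - 1) * p) * Real.exp (-((Real.exp t - 1) * p)) := by
        refine mul_le_mul_of_nonneg_right ?_ h2.le
        linarith
    _ = 1 := by rw [← Real.exp_add]; simp

theorem sum_mul_exp_indicator {X : Type*} [Fintype X] (w : X → ℝ) (hw : ∑ x, w x = 1)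
    (Y : X → Prop) [DecidablePred Y] (t : ℝ) :
    ∑ x, w x * Real.exp (t * if Y x then 1 else 0) =
      1 + (∑ x, w x * if Y x then 1 else 0) * (Real.exp t - 1) := by
  have h : ∀ x, w x * Real.exp (t * if Y x then 1 else 0) =
      w x + (w x * if Y x then 1 else 0) * (Real.exp t - 1) := by
    intro x
    by_cases hY : Y x
    · simp only [hY, if_true, mul_one]; ring
    · simp [hY]
  simp only [h, Finset.sum_add_distrib, hw, ← Finset.sum_mul]

/-- For a Bernoulli variable of mean `q` the moment generating function is `1 + q (eᵗ - 1) ≤ exp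
((eᵗ - 1) q)`, so subtracting `(eᵗ - 1) q` in the exponent compensates it. -/
theorem sum_mul_exp_indicator_sub_le_one {X : Type*} [Fintype X] (w : X → ℝ)
    (hw : ∑ x, w x = 1) (Y : X → Prop) [DecidablePred Y] (t : ℝ) :
    ∑ x, w x * Real.exp ((t * if Y x then 1 else 0) -
      (Real.exp t - 1) * ∑ x, w x * if Y x then 1 else 0) ≤ 1 := by
  generalize hq : (∑ x, w x * if Y x then (1 : ℝ) else 0) = q
  have hx : ∀ y, Real.exp (y - (Real.exp t - 1) * q) =
      Real.exp y * Real.exp (-((Real.exp t - 1) * q)) := fun y => by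
    rw [← Real.exp_add, ← sub_eq_add_neg]
  simp only [hx, ← mul_assoc]
  rw [← Finset.sum_mul, sum_mul_exp_indicator w hw, hq]
  exact exp_mgf_bound _ t

end Chernoff

/-! ### The law of an exploration episode -/

section Mixture

variable {S A : Type*} [Fintype S] {H : ℕ} (M : EpisodicMDP S A H)

theorem EpisodicMDP.nonempty_state {A : Type*} {H : ℕ} (M : EpisodicMDP S A H) : Nonempty S := by
  by_contra h
  rw [not_nonempty_iff] at h
  have := M.init_sum
  simp at this

theorem EpisodicMDP.trajProb_nonneg (π : Policy S A H) (τ : Traj S A H) :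
    0 ≤ trajProb M.init M.trans π τ := by
  refine mul_nonneg (M.init_nonneg _) (Finset.prod_nonneg fun h _ => ?_)
  split_ifs
  · exact M.trans_nonneg _ _ _ _
  · exact le_rfl

theorem EpisodicMDP.occ_nonneg (π : Policy S A H) (n : ℕ) (s : S) :
    0 ≤ occ M.init (polKernel M.trans π) n s :=
  PrivateRL.occ_nonneg M.init_nonneg (fun _ _ _ => M.trans_nonneg _ _ _ _) n s

theorem EpisodicMDP.sum_occ (π : Policy S A H) (n : ℕ) (hn : n ≤ H) :
    ∑ s, occ M.init (polKernel M.trans π) n s = 1 :=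
  sum_occ_eq_one M.init_sum (fun _ _ => M.trans_sum _ _ _) n hn

theorem EpisodicMDP.sum_trajProb [Fintype A] (π : Policy S A H) :
    ∑ τ, trajProb M.init M.trans π τ = 1 := by
  have h := sum_trajProb_mul M.init M.trans π (fun _ => 1)
  simp only [mul_one] at h
  have h2 := sum_pathWeight_last M.init (polKernel M.trans π) (fun _ => 1)
  simp only [mul_one] at h2
  rw [h, h2, M.sum_occ π H le_rfl]

variable [Fintype A] (pol : S → A → Policy S A H)

theorem mixtureProb_nonneg (τ : Traj S A H) : 0 ≤ mixtureProb M pol τ := by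
  refine mul_nonneg (by positivity) (Finset.sum_nonneg fun s _ => Finset.sum_nonneg fun a _ => ?_)
  exact M.trajProb_nonneg _ _

theorem sum_mixtureProb_mul (f : Traj S A H → ℝ) :
    ∑ τ, mixtureProb M pol τ * f τ =
      1 / ((Fintype.card S : ℝ) * (Fintype.card A : ℝ)) *
        ∑ s, ∑ a, ∑ τ, trajProb M.init M.trans (pol s a) τ * f τ := by
  simp only [mixtureProb, mul_assoc, ← Finset.mul_sum, Finset.sum_mul]
  congr 1
  rw [Finset.sum_comm]
  refine Finset.sum_congr rfl fun s _ => ?_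
  rw [Finset.sum_comm]

theorem sum_mixtureProb_mul_le_one [Nonempty A] (f : Traj S A H → ℝ)
    (hf : ∀ π, ∑ τ, trajProb M.init M.trans π τ * f τ ≤ 1) :
    ∑ τ, mixtureProb M pol τ * f τ ≤ 1 := by
  have := M.nonempty_state
  have hS : (0 : ℝ) < Fintype.card S := by exact_mod_cast Fintype.card_pos
  have hA : (0 : ℝ) < Fintype.card A := by exact_mod_cast Fintype.card_pos
  rw [sum_mixtureProb_mul, one_div_mul_eq_div, div_le_one (by positivity)]
  refine (Finset.sum_le_sum fun s _ => Finset.sum_le_sum fun a _ => hf (pol s a)).trans ?_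
  simp

theorem sum_mixtureProb [Nonempty A] : ∑ τ, mixtureProb M pol τ = 1 := by
  have := M.nonempty_state
  have hS : (Fintype.card S : ℝ) ≠ 0 := by exact_mod_cast Fintype.card_ne_zero
  have hA : (Fintype.card A : ℝ) ≠ 0 := by exact_mod_cast Fintype.card_ne_zero
  have h := sum_mixtureProb_mul M pol (fun _ => 1)
  simp only [mul_one, M.sum_trajProb] at h
  rw [h]
  simp
  field_simp

open Classical in
/-- The probability that an episode of the mixture makes the transition from `(s, a)` to `s'`
at step `h`. -/
noncomputable def mixtureNext (h : Fin H) (s : S) (a : A) (s' : S) : ℝ :=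
  ∑ τ : Traj S A H, mixtureProb M pol τ *
    if τ.1 h.castSucc = s ∧ τ.2 h = a ∧ τ.1 h.succ = s' then 1 else 0

open Classical in
theorem sum_trajProb_indicator (π : Policy S A H) (h : Fin H) (s : S) (a : A) (s' : S) :
    (∑ τ : Traj S A H, trajProb M.init M.trans π τ *
      if τ.1 h.castSucc = s ∧ τ.2 h = a ∧ τ.1 h.succ = s' then 1 else 0) =
      if π h s = a then occ M.init (polKernel M.trans π) h s * M.trans h s a s' else 0 := by
  rw [sum_trajProb_pair M.init M.trans M.trans_sum π h
    (fun u b v => if u = s ∧ b = a ∧ v = s' then 1 else 0), Finset.sum_eq_single s]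
  · by_cases ha : π h s = a
    · simp [ha]
    · simp [ha]
  · intro u _ hu; simp [hu]
  · simp

-- The mixture plays the policy designed for `(s, a)` with probability `1/(SA)`, and the
-- contributions of the other policies are nonnegative.
open Classical in
theorem occ_mul_trans_le_mixtureNext [Nonempty A] (h : Fin H) (s : S) (a : A) (s' : S) :
    (if pol s a h s = a then
      occ M.init (polKernel M.trans (pol s a)) h s * M.trans h s a s' else 0) ≤
      (Fintype.card S : ℝ) * (Fintype.card A : ℝ) * mixtureNext M pol h s a s' := by
  have := M.nonempty_state
  have hS : (Fintype.card S : ℝ) ≠ 0 := by exact_mod_cast Fintype.card_ne_zero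
  have hA : (Fintype.card A : ℝ) ≠ 0 := by exact_mod_cast Fintype.card_ne_zero
  have hnn : ∀ t b, 0 ≤ ∑ τ : Traj S A H, trajProb M.init M.trans (pol t b) τ *
      if τ.1 h.castSucc = s ∧ τ.2 h = a ∧ τ.1 h.succ = s' then 1 else 0 := by
    refine fun t b => Finset.sum_nonneg fun τ _ => mul_nonneg (M.trajProb_nonneg _ _) ?_
    split_ifs <;> norm_num
  rw [mixtureNext, sum_mixtureProb_mul, ← sum_trajProb_indicator, ← mul_assoc, mul_one_div_cancel
    (mul_ne_zero hS hA), one_mul]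
  refine le_trans ?_ (Finset.single_le_sum (fun t _ => Finset.sum_nonneg fun b _ => hnn t b)
    (Finset.mem_univ s))
  exact Finset.single_le_sum (fun b _ => hnn s b) (Finset.mem_univ a)

open Classical in
/-- The exponential supermartingale increment comparing transitions with visits. -/
theorem sum_mixtureProb_mul_exp_le_one [Nonempty A] (h : Fin H) (s : S) (a : A) (s' : S) (t : ℝ) :
    ∑ τ : Traj S A H, mixtureProb M pol τ * Real.exp (
      (t * if τ.1 h.castSucc = s ∧ τ.2 h = a ∧ τ.1 h.succ = s' then 1 else 0) -
      (Real.exp t - 1) * M.trans h s a s' *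
        if τ.1 h.castSucc = s ∧ τ.2 h = a then 1 else 0) ≤ 1 := by
  refine sum_mixtureProb_mul_le_one M pol _ fun π => ?_
  rw [sum_trajProb_pair M.init M.trans M.trans_sum π h (fun u b v => Real.exp (
      (t * if u = s ∧ b = a ∧ v = s' then 1 else 0) -
      (Real.exp t - 1) * M.trans h s a s' * if u = s ∧ b = a then 1 else 0))]
  refine (Finset.sum_le_sum fun u _ => ?_).trans (M.sum_occ π h h.2.le).le
  refine mul_le_of_le_one_right (M.occ_nonneg _ _ _) ?_
  -- At `(s, a)` the next state is a fresh draw from the true kernel, giving the Bernoulli bound;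
  -- elsewhere the exponent is zero. Compensating inside each episode handles the random number of
  -- visits without conditioning on it.
  by_cases hu : u = s ∧ π h u = a
  · obtain ⟨rfl, rfl⟩ := hu
    have := sum_mul_exp_indicator_sub_le_one (M.trans h u (π h u)) (M.trans_sum h u (π h u))
      (fun v => v = s') t
    simpa using this
  · have hu' : ∀ v, ¬ (u = s ∧ π h u = a ∧ v = s') := fun v hv => hu ⟨hv.1, hv.2.1⟩
    simp [hu, hu', M.trans_sum]

end Mixture

theorem visitsNext_le_visits {S A : Type*} {H n : ℕ} (D : Fin n → Traj S A H)
    (h : Fin H) (s : S) (a : A) (s' : S) :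
    visitsNext D h s a s' ≤ visits D h s a := by
  classical
  unfold visitsNext visits
  exact Finset.card_le_card (Finset.monotone_filter_right _ fun i _ hi => ⟨hi.1, hi.2.1⟩)

/-! ### Concentration of the counts of one batch -/

section Counts

variable {S A : Type*} [Fintype S] [Fintype A] [Nonempty A] {H n : ℕ} (M : EpisodicMDP S A H)

/-- The counts of the dataset `D` for the tuple `(h, s, a, s')` are close to what is expected
when the episodes follow the mixture of the policies `p`. -/
structure Concentrated (x : ℝ) (h : Fin H) (s : S) (a : A) (s' : S)
    (p : S → A → Policy S A H) (D : Fin n → Traj S A H) : Prop where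
  upper : (H : ℝ)⁻¹ * visitsNext D h s a s' -
    (Real.exp (H : ℝ)⁻¹ - 1) * M.trans h s a s' * visits D h s a < x
  lower : -(H : ℝ)⁻¹ * visitsNext D h s a s' -
    (Real.exp (-(H : ℝ)⁻¹) - 1) * M.trans h s a s' * visits D h s a < x
  mixture : (-1) * (visitsNext D h s a s' : ℝ) -
    n * ((Real.exp (-1) - 1) * mixtureNext M p h s a s') < x

open Classical in
theorem sum_prod_mixtureProb_counts_le (x t : ℝ) (h : Fin H) (s : S) (a : A) (s' : S)
    (p : S → A → Policy S A H) :
    ∑ D : Fin n → Traj S A H, (if x ≤ t * visitsNext D h s a s' -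
        (Real.exp t - 1) * M.trans h s a s' * visits D h s a then
      ∏ i, mixtureProb M p (D i) else 0) ≤ Real.exp (-x) := by
  refine le_of_eq_of_le ?_ (sum_prod_le_exp_neg (mixtureProb M p) _ (mixtureProb_nonneg M p)
    (sum_mixtureProb_mul_exp_le_one M p h s a s' t) n x)
  simp only [Finset.sum_sub_distrib, ← Finset.mul_sum, Finset.sum_boole]
  rfl

open Classical in
theorem sum_prod_mixtureProb_next_le (x t : ℝ) (h : Fin H) (s : S) (a : A) (s' : S)
    (p : S → A → Policy S A H) :
    ∑ D : Fin n → Traj S A H, (if x ≤ t * visitsNext D h s a s' -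
        n * ((Real.exp t - 1) * mixtureNext M p h s a s') then
      ∏ i, mixtureProb M p (D i) else 0) ≤ Real.exp (-x) := by
  refine le_of_eq_of_le ?_ (sum_prod_le_exp_neg (mixtureProb M p) _ (mixtureProb_nonneg M p)
    (sum_mul_exp_indicator_sub_le_one (mixtureProb M p) (sum_mixtureProb M p)
      (fun τ => τ.1 h.castSucc = s ∧ τ.2 h = a ∧ τ.1 h.succ = s') t) n x)
  refine Finset.sum_congr rfl fun D _ => ?_
  rw [Finset.sum_sub_distrib, Finset.sum_const, Finset.card_univ, Fintype.card_fin, nsmul_eq_mul,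
    ← Finset.mul_sum]
  have hcount : (visitsNext D h s a s' : ℝ) = ∑ i, if (D i).1 h.castSucc = s ∧ (D i).2 h = a ∧
      (D i).1 h.succ = s' then 1 else 0 := by
    rw [Finset.sum_boole]
    rfl
  rw [hcount]
  rfl

open Classical in
theorem sum_prod_mixtureProb_not_concentrated_le (x : ℝ) (h : Fin H) (s : S) (a : A) (s' : S)
    (p : S → A → Policy S A H) :
    ∑ D : Fin n → Traj S A H, (if ¬ Concentrated M x h s a s' p D then
      ∏ i, mixtureProb M p (D i) else 0) ≤ 3 * Real.exp (-x) := by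
  have h1 := sum_prod_mixtureProb_counts_le (n := n) M x (H : ℝ)⁻¹ h s a s' p
  have h2 := sum_prod_mixtureProb_counts_le (n := n) M x (-(H : ℝ)⁻¹) h s a s' p
  have h3 := sum_prod_mixtureProb_next_le (n := n) M x (-1) h s a s' p
  have key := add_le_add (add_le_add h1 h2) h3
  rw [← Finset.sum_add_distrib, ← Finset.sum_add_distrib] at key
  refine (Finset.sum_le_sum fun D _ => ?_).trans (key.trans (by linarith))
  have hw : 0 ≤ ∏ i, mixtureProb M p (D i) :=
    Finset.prod_nonneg fun i _ => mixtureProb_nonneg M p _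
  by_cases hD : Concentrated M x h s a s' p D
  · rw [if_neg (not_not.2 hD)]
    refine add_nonneg (add_nonneg ?_ ?_) ?_ <;> split_ifs <;> first | exact hw | exact le_rfl
  · rw [if_pos hD]
    by_cases c1 : x ≤ (H : ℝ)⁻¹ * visitsNext D h s a s' -
        (Real.exp (H : ℝ)⁻¹ - 1) * M.trans h s a s' * visits D h s a
    · rw [if_pos c1, add_assoc]
      refine le_add_of_nonneg_right (add_nonneg ?_ ?_) <;> split_ifs <;>
        first | exact hw | exact le_rfl
    · by_cases c2 : x ≤ -(H : ℝ)⁻¹ * visitsNext D h s a s' -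
          (Real.exp (-(H : ℝ)⁻¹) - 1) * M.trans h s a s' * visits D h s a
      · rw [if_pos c2, add_right_comm]
        refine le_add_of_nonneg_left (add_nonneg ?_ ?_) <;> split_ifs <;>
          first | exact hw | exact le_rfl
      · have c3 : x ≤ (-1) * (visitsNext D h s a s' : ℝ) -
            n * ((Real.exp (-1) - 1) * mixtureNext M p h s a s') := by
          by_contra c3
          exact hD ⟨not_le.1 c1, not_le.1 c2, not_le.1 c3⟩
        rw [if_neg c1, if_neg c2, if_pos c3, add_zero, zero_add]

end Counts

/-! ### From batch weights to probabilities in a run -/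

namespace Run

variable {S A Ω : Type*} [Fintype S] [Fintype A] [Nonempty A] {H : ℕ}
  {M : EpisodicMDP S A H} [mΩ : MeasurableSpace Ω] {μ : Measure Ω} [IsProbabilityMeasure μ]
  {K : ℕ} {len : Fin K → ℕ} {E ι : ℝ}

/-- The event that the exploration policies equal `p` belongs to the past of the batch, so the
conditional law of the data can be integrated over it, and there it is a constant. -/
theorem measureReal_pol_inter_data (R : Run M μ len E ι) (k : Fin K) (h : Fin H)
    (p : S → A → Policy S A H) (d : Fin (len k / H) → Traj S A H) :
    μ.real ({ω | R.pol k h ω = p} ∩ {ω | R.data k h ω = d}) =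
      μ.real {ω | R.pol k h ω = p} * ∏ i, mixtureProb M p (d i) := by
  have hm : R.hist ((k : ℕ) * H + h) ≤ mΩ := R.hist.le _
  have hp := R.pol_measurable k h p
  have hd : MeasurableSet {ω | R.data k h ω = d} := R.hist.le _ _ (R.data_measurable k h d)
  have hint : Integrable ({ω | R.data k h ω = d}.indicator fun _ => (1 : ℝ)) μ :=
    (integrable_const _).indicator hd
  have key := setIntegral_condExp hm hint hp
  rw [setIntegral_indicator hd, setIntegral_const, smul_eq_mul, mul_one] at key
  rw [← key, setIntegral_congr_ae (g := fun _ => ∏ i, mixtureProb M p (d i)) (hm _ hp),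
    setIntegral_const, smul_eq_mul]
  filter_upwards [R.data_law k h d] with ω hω hωp
  rw [hω, show R.pol k h ω = p from hωp]

-- The exploration policies are random but take finitely many values. Splitting over these values
-- turns a bound uniform in fixed policies into one for the policies chosen by the run.
open Classical in
theorem measure_data_mem_le (R : Run M μ len E ι) (k : Fin K) (h : Fin H)
    (B : (S → A → Policy S A H) → (Fin (len k / H) → Traj S A H) → Prop) {ε : ℝ} (hε0 : 0 ≤ ε)
    (hε : ∀ p, ∑ d, (if B p d then ∏ i, mixtureProb M p (d i) else 0) ≤ ε) :
    μ {ω | B (R.pol k h ω) (R.data k h ω)} ≤ ENNReal.ofReal ε := by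
  have hpm : ∀ p, MeasurableSet {ω | R.pol k h ω = p} := fun p =>
    R.hist.le _ _ (R.pol_measurable k h p)
  have hpart : ∑ p, μ.real {ω | R.pol k h ω = p} = 1 := by
    rw [← measureReal_biUnion_finset (f := fun p => {ω | R.pol k h ω = p})
      (fun p _ q _ hpq => Set.disjoint_left.2 fun ω h1 h2 => hpq (Eq.trans (Eq.symm h1) h2))
      (fun p _ => hpm p), ← probReal_univ (μ := μ)]
    congr 1
    ext ω
    simp
  have hsub : {ω | B (R.pol k h ω) (R.data k h ω)} ⊆ ⋃ p, ⋃ d, ⋃ (_ : B p d),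
      ({ω | R.pol k h ω = p} ∩ {ω | R.data k h ω = d}) := by
    intro ω hω
    simp only [Set.mem_iUnion]
    exact ⟨_, _, hω, rfl, rfl⟩
  rw [ENNReal.le_ofReal_iff_toReal_le (measure_ne_top _ _) hε0]
  change μ.real _ ≤ ε
  refine (measureReal_mono hsub).trans ?_
  calc _ ≤ ∑ p, μ.real (⋃ d, ⋃ (_ : B p d),
        ({ω | R.pol k h ω = p} ∩ {ω | R.data k h ω = d})) := measureReal_iUnion_fintype_le _
    _ ≤ ∑ p, ∑ d, μ.real (⋃ (_ : B p d),
        ({ω | R.pol k h ω = p} ∩ {ω | R.data k h ω = d})) :=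
        Finset.sum_le_sum fun p _ => measureReal_iUnion_fintype_le _
    _ = ∑ p, μ.real {ω | R.pol k h ω = p} *
          ∑ d, (if B p d then ∏ i, mixtureProb M p (d i) else 0) := by
        refine Finset.sum_congr rfl fun p _ => ?_
        rw [Finset.mul_sum]
        refine Finset.sum_congr rfl fun d _ => ?_
        by_cases hB : B p d
        · simp [hB, measureReal_pol_inter_data]
        · simp [hB]
    _ ≤ ∑ p, μ.real {ω | R.pol k h ω = p} * ε :=
        Finset.sum_le_sum fun p _ => mul_le_mul_of_nonneg_left (hε p) measureReal_nonneg
    _ = ε := by rw [← Finset.sum_mul, hpart, one_mul]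

/-- With high probability all the counts of all the layers and stages are concentrated. -/
theorem measure_not_concentrated_le (R : Run M μ len E ι) (x : ℝ) :
    μ {ω | ¬ ∀ k h s a s', Concentrated M x h s a s' (R.pol k h ω) (R.data k h ω)} ≤
      ENNReal.ofReal (K * H * Fintype.card S * Fintype.card A * Fintype.card S *
        (3 * Real.exp (-x))) := by
  classical
  have hsub : {ω | ¬ ∀ k h s a s', Concentrated M x h s a s' (R.pol k h ω) (R.data k h ω)} ⊆
      ⋃ y : Fin K × Fin H × S × A × S, {ω | ¬ Concentrated M x y.2.1 y.2.2.1 y.2.2.2.1 y.2.2.2.2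
        (R.pol y.1 y.2.1 ω) (R.data y.1 y.2.1 ω)} := by
    intro ω hω
    simp only [Set.mem_ofPred_eq, not_forall] at hω
    obtain ⟨k, h, s, a, s', hω⟩ := hω
    exact Set.mem_iUnion.2 ⟨(k, h, s, a, s'), hω⟩
  refine (measure_mono hsub).trans ((measure_iUnion_fintype_le _ _).trans ?_)
  refine (Finset.sum_le_sum (g := fun _ => ENNReal.ofReal (3 * Real.exp (-x)))
    fun y _ => ?_).trans ?_
  · exact R.measure_data_mem_le y.1 y.2.1
      (fun p d => ¬ Concentrated M x y.2.1 y.2.2.1 y.2.2.2.1 y.2.2.2.2 p d) (by positivity)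
      (fun p => by
        convert sum_prod_mixtureProb_not_concentrated_le M x y.2.1 y.2.2.1 y.2.2.2.1 y.2.2.2.2 p)
  · rw [← ENNReal.ofReal_sum_of_nonneg (fun _ _ => by positivity)]
    simp [mul_assoc]

end Run

/-! ### Relative accuracy of the private transition estimates -/

/-- Private counts of a frequent tuple give the transition probability up to a factor `1 + 5θ`. -/
theorem private_ratio_close {θ p N₂ N₃ n₂ n₃ E ι : ℝ} (hθ : 0 < θ) (hθ1 : θ ≤ 1) (hp : 0 ≤ p)
    (hp1 : p ≤ 1) (hN : N₃ ≤ N₂) (hE : 1 ≤ E) (hι : 1 / 2 ≤ ι) (hfreq : 6 * E * ι < θ ^ 2 * n₃)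
    (h₃ : |n₃ - N₃| ≤ E) (h₂ : N₂ ≤ n₂) (h₂' : n₂ ≤ N₂ + E) (hN₂ : 0 ≤ N₂)
    (upper : θ * N₃ - (Real.exp θ - 1) * p * N₂ < 2 * ι)
    (lower : -θ * N₃ - (Real.exp (-θ) - 1) * p * N₂ < 2 * ι) :
    0 ≤ n₃ / n₂ ∧ n₃ / n₂ ≤ (1 + 5 * θ) * p ∧ p ≤ (1 + 5 * θ) * (n₃ / n₂) := by
  obtain ⟨h₃a, h₃b⟩ := abs_le.1 h₃
  have hpN : 0 ≤ p * N₂ := mul_nonneg hp hN₂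
  have hEι : E ≤ 2 * (E * ι) := by nlinarith
  have hιE : ι ≤ E * ι := by nlinarith
  have hn₃ : 0 < n₃ := by
    by_contra hc
    nlinarith [sq_nonneg θ]
  have hθn : θ ^ 2 * n₃ ≤ θ * n₃ := by nlinarith [mul_pos hθ hn₃]
  -- The threshold constant `6` makes both errors, the privacy noise `E` and the deviation term `2 *
  -- ι / θ`, at most `θ * n₃ / 3`.
  have hE' : E ≤ θ * n₃ / 3 := by linarith
  have hι' : 2 * ι ≤ θ * (θ * n₃ / 3) := by nlinarith
  have hθn' : θ * n₃ ≤ n₃ := by nlinarith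
  have hn₂ : 0 < n₂ := by linarith
  have e1 : Real.exp θ - 1 ≤ θ * (1 + θ) := by
    have := Real.abs_exp_sub_one_sub_id_le (x := θ) (by rw [abs_of_pos hθ]; exact hθ1)
    linarith [(abs_le.1 this).2]
  have e2 : θ ≤ (1 + θ) * (1 - Real.exp (-θ)) := by
    have h1 : 1 + θ ≤ Real.exp θ := by linarith [Real.add_one_le_exp θ]
    have h2 : (1 + θ) * Real.exp (-θ) ≤ Real.exp θ * Real.exp (-θ) :=
      mul_le_mul_of_nonneg_right h1 (Real.exp_pos _).le
    rw [← Real.exp_add, add_neg_cancel, Real.exp_zero] at h2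
    linarith
  -- The tilts `± θ`, with `θ = 1/H` in the application, balance the two errors: dividing by `θ`
  -- leaves a relative error of order `θ` and an additive `2 * ι / θ`.
  have u1 : N₃ ≤ (1 + θ) * (p * N₂) + θ * n₃ / 3 := by
    have h1 : (Real.exp θ - 1) * (p * N₂) ≤ θ * (1 + θ) * (p * N₂) :=
      mul_le_mul_of_nonneg_right e1 hpN
    refine le_of_mul_le_mul_left ?_ hθ
    nlinarith
  have l1 : p * N₂ ≤ (1 + θ) * (N₃ + θ * n₃ / 3) := by
    have h1 : θ * (p * N₂) ≤ (1 + θ) * (1 - Real.exp (-θ)) * (p * N₂) :=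
      mul_le_mul_of_nonneg_right e2 hpN
    have h2 : (1 - Real.exp (-θ)) * (p * N₂) ≤ θ * N₃ + θ * (θ * n₃ / 3) := by nlinarith
    have h3 := mul_le_mul_of_nonneg_left h2 (by linarith : (0 : ℝ) ≤ 1 + θ)
    refine le_of_mul_le_mul_left ?_ hθ
    nlinarith
  refine ⟨by positivity, ?_, ?_⟩
  · rw [div_le_iff₀ hn₂]
    have h1 : n₃ * (1 - 2 * θ / 3) ≤ (1 + θ) * (p * n₂) := by
      have : p * N₂ ≤ p * n₂ := mul_le_mul_of_nonneg_left h₂ hp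
      nlinarith
    have hpn : 0 ≤ p * n₂ := by positivity
    have h2 := mul_le_mul_of_nonneg_left h1 (by linarith : (0 : ℝ) ≤ 1 + 2 * θ)
    -- Since `θ ≤ 1`, `(1 + 2θ)(1 - 2θ/3) ≥ 1` and `(1 + 2θ)(1 + θ) ≤ 1 + 5θ`, which is the source
    -- of the constant `5`.
    have h3 : n₃ ≤ (1 + 2 * θ) * (n₃ * (1 - 2 * θ / 3)) := by nlinarith
    have h4 : (1 + 2 * θ) * ((1 + θ) * (p * n₂)) ≤ (1 + 5 * θ) * (p * n₂) := by
      rw [← mul_assoc]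
      exact mul_le_mul_of_nonneg_right (by nlinarith) hpn
    linarith
  · rw [← mul_div_assoc, le_div_iff₀ hn₂]
    have h1 : p * n₂ ≤ p * N₂ + E := by nlinarith
    have h2 : (1 + θ) * (N₃ + θ * n₃ / 3) ≤ (1 + θ) * (n₃ + 2 * (θ * n₃ / 3)) :=
      mul_le_mul_of_nonneg_left (by linarith) (by linarith)
    nlinarith

/-! ### Loss of value through removed transitions -/

section Kernels

variable {S A : Type*} [Fintype S] {H : ℕ}

theorem absorbingKernel_sum (P : Fin H → S → A → S → ℝ) (hP : ∀ h s a, ∑ s', P h s a s' = 1)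
    (F : Set (Fin H × S × A × S)) (h : Fin H) (x : Option S) (a : A) :
    ∑ y, absorbingKernel P F h x a y = 1 := by
  classical
  rw [Fintype.sum_option]
  cases x with
  | none => simp [absorbingKernel]
  | some s =>
    simp only [absorbingKernel]
    rw [← Finset.sum_add_distrib, ← hP h s a]
    refine Finset.sum_congr rfl fun s' _ => ?_
    split_ifs <;> simp

theorem crudeKernel_sum (n2 : Fin H → S → A → ℝ) (n3 : Fin H → S → A → S → ℝ)
    (F : Set (Fin H × S × A × S)) (h : Fin H) (x : Option S) (a : A) :
    ∑ y, crudeKernel n2 n3 F h x a y = 1 := by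
  rw [Fintype.sum_option]
  cases x with
  | none => simp [crudeKernel]
  | some s => simp [crudeKernel]

variable (M : EpisodicMDP S A H) (F : Set (Fin H × S × A × S))

theorem extKernel_absorbing_nonneg (π : Policy S A H) (h : Fin H) (u v : S) :
    0 ≤ extKernel (absorbingKernel M.trans F) π h u v := by
  simp only [extKernel, absorbingKernel]
  split_ifs
  · exact le_rfl
  · exact M.trans_nonneg _ _ _ _

theorem extKernel_absorbing_le (π : Policy S A H) (h : Fin H) (u v : S) :
    extKernel (absorbingKernel M.trans F) π h u v ≤ polKernel M.trans π h u v := by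
  simp only [extKernel, absorbingKernel, polKernel]
  split_ifs
  · exact M.trans_nonneg _ _ _ _
  · exact le_rfl

theorem occ_absorbing_le (π : Policy S A H) (n : ℕ) (s : S) :
    occ M.init (extKernel (absorbingKernel M.trans F) π) n s ≤
      occ M.init (polKernel M.trans π) n s := by
  have h := occ_le_pow_mul_occ (κ := 1) (q₂ := polKernel M.trans π) M.init_nonneg (extKernel_absorbing_nonneg M F π)
    zero_le_one (fun h u v => by
      rw [one_mul]; exact extKernel_absorbing_le M F π h u v)
    (fun _ _ _ => M.trans_nonneg _ _ _ _) n s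
  simpa using h

/-- The loss of value in the absorbing MDP is controlled by the probabilities of the removed
transitions along the policy. -/
theorem value_sub_valueExt_absorbing [Fintype A] [Nonempty A] (π : Policy S A H)
    (r : Fin H → S → A → ℝ) (hr : ∀ h s a, 0 ≤ r h s a ∧ r h s a ≤ 1) {B : ℝ} (hB : 0 ≤ B)
    (hF : ∀ h s s', (h, s, π h s, s') ∈ F →
      occ M.init (extKernel (absorbingKernel M.trans F) π) h s * M.trans h s (π h s) s' ≤ B) :
    0 ≤ value M.init M.trans π r - valueExt M.init (absorbingKernel M.trans F) π r ∧
    value M.init M.trans π r - valueExt M.init (absorbingKernel M.trans F) π r ≤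
      (H : ℝ) ^ 2 * (Fintype.card S : ℝ) ^ 2 * B := by
  rw [value_eq_sum_occ _ _ M.trans_sum,
    valueExt_eq_sum_occ _ _ (absorbingKernel_sum _ M.trans_sum _) (fun _ _ _ => rfl),
    ← Finset.sum_sub_distrib]
  simp only [← Finset.sum_sub_distrib, ← sub_mul]
  have hocc := fun (n : ℕ) s => sub_nonneg.2 (occ_absorbing_le M F π n s)
  refine ⟨Finset.sum_nonneg fun h _ => Finset.sum_nonneg fun s _ =>
    mul_nonneg (hocc h s) (hr _ _ _).1, ?_⟩
  have hL : ∀ h : Fin H, ∑ u, ∑ v, occ M.init (extKernel (absorbingKernel M.trans F) π) h u *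
      (polKernel M.trans π h u v - extKernel (absorbingKernel M.trans F) π h u v) ≤
      (Fintype.card S : ℝ) ^ 2 * B := by
    intro h
    -- The two kernels differ only on removed tuples, where the difference is the full true
    -- transition probability.
    refine (Finset.sum_le_sum fun u _ => Finset.sum_le_sum (g := fun _ => B)
      fun v _ => ?_).trans_eq ?_
    · by_cases hm : (h, u, π h u, v) ∈ F
      · simpa [polKernel, extKernel, absorbingKernel, hm] using hF h u v hm
      · simpa [polKernel, extKernel, absorbingKernel, hm] using hB
    · simp [pow_two, mul_assoc]
  have hstep : ∀ h : Fin H, ∑ s, (occ M.init (polKernel M.trans π) h s -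
      occ M.init (extKernel (absorbingKernel M.trans F) π) h s) * r h s (π h s) ≤
      H * ((Fintype.card S : ℝ) ^ 2 * B) := by
    intro h
    calc _ ≤ ∑ s, (occ M.init (polKernel M.trans π) h s -
          occ M.init (extKernel (absorbingKernel M.trans F) π) h s) :=
          Finset.sum_le_sum fun s _ => mul_le_of_le_one_right (hocc h s) (hr _ _ _).2
      _ ≤ (h : ℕ) * ((Fintype.card S : ℝ) ^ 2 * B) :=
          sum_occ_sub_occ_le M.init_sum (fun _ _ => M.trans_sum _ _ _) hL h h.2.le
      _ ≤ H * ((Fintype.card S : ℝ) ^ 2 * B) := by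
          refine mul_le_mul_of_nonneg_right ?_ (by positivity)
          exact_mod_cast h.2.le
  refine (Finset.sum_le_sum fun h _ => hstep h).trans_eq ?_
  simp
  ring

end Kernels

/-! ### Coverage of active policies by the crude exploration -/

namespace Run

variable {S A Ω : Type*} [Fintype S] [Fintype A] [Nonempty A] {H : ℕ}
  {M : EpisodicMDP S A H} [mΩ : MeasurableSpace Ω] {μ : Measure Ω}
  {K : ℕ} {len : Fin K → ℕ} {E ι : ℝ}

/-- The crude transition estimate of stage `k`. -/
noncomputable def crude (R : Run M μ len E ι) (k : Fin K) (ω : Ω) :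
    Fin H → Option S → A → Option S → ℝ :=
  crudeKernel (R.priv2 k ω) (R.priv3 k ω) (R.infreq k ω)

/-- On infrequent tuples both kernels vanish; on the others `private_ratio_close` applies with `θ =
1/H`, whose hypothesis on the count is the negated threshold. -/
theorem extKernel_crude_close (R : Run M μ len E ι) {k : Fin K} {ω : Ω} (hE : 1 ≤ E)
    (hι : 1 / 2 ≤ ι) (hacc : R.CountsAccurate ω)
    (hconc : ∀ h s a s', Concentrated M (2 * ι) h s a s' (R.pol k h ω) (R.data k h ω))
    (π : Policy S A H) (h : Fin H) (u v : S) :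
    0 ≤ extKernel (R.crude k ω) π h u v ∧
    extKernel (R.crude k ω) π h u v ≤
      (1 + 5 * (H : ℝ)⁻¹) * extKernel (R.absorbing k ω) π h u v ∧
    extKernel (R.absorbing k ω) π h u v ≤
      (1 + 5 * (H : ℝ)⁻¹) * extKernel (R.crude k ω) π h u v := by
  by_cases hm : (h, u, π h u, v) ∈ R.infreq k ω
  · simp [extKernel, crude, crudeKernel, absorbing, absorbingKernel, hm]
  · have hH : (1 : ℝ) ≤ H := by exact_mod_cast h.pos
    have hH0 : (0 : ℝ) < H := by linarith
    simp only [extKernel, crude, crudeKernel, absorbing, absorbingKernel, hm, if_false]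
    obtain ⟨⟨h2, h2'⟩, h3⟩ := hacc k h u (π h u)
    have hc := hconc h u (π h u) v
    refine private_ratio_close (inv_pos.2 hH0) (inv_le_one_of_one_le₀ hH)
      (M.trans_nonneg _ _ _ _) ?_ ?_ hE hι ?_ (h3 v) h2 h2' (Nat.cast_nonneg _) hc.upper hc.lower
    · rw [← M.trans_sum h u (π h u)]
      exact Finset.single_le_sum (fun w _ => M.trans_nonneg _ _ _ w) (Finset.mem_univ v)
    · exact Nat.cast_le.2 (visitsNext_le_visits _ _ _ _ _)
    · simp only [infreq, infrequent, Set.mem_ofPred_eq, not_le] at hm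
      rw [inv_pow, ← div_eq_inv_mul, lt_div_iff₀ (by positivity)]
      linarith

/-- The crude exploration covers every active policy: occupancies in the absorbing MDP are bounded
by those of the exploration policies in the true MDP. -/
theorem occ_absorbing_le_explore (R : Run M μ len E ι) {k : Fin K} {ω : Ω} (hE : 1 ≤ E)
    (hι : 1 / 2 ≤ ι) (hacc : R.CountsAccurate ω)
    (hconc : ∀ h s a s', Concentrated M (2 * ι) h s a s' (R.pol k h ω) (R.data k h ω))
    {π : Policy S A H} (hπ : π ∈ R.active k ω) (h : Fin H) (s : S)
    [Decidable (R.pol k h ω s (π h s) h s = π h s)] :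
    occ M.init (extKernel (R.absorbing k ω) π) h s ≤
      Real.exp 10 * if R.pol k h ω s (π h s) h s = π h s then
        occ M.init (polKernel M.trans (R.pol k h ω s (π h s))) h s else 0 := by
  set κ : ℝ := 1 + 5 * (H : ℝ)⁻¹ with hκ
  have hH : (1 : ℝ) ≤ H := by exact_mod_cast h.pos
  have hκ1 : 1 ≤ κ := by rw [hκ]; linarith [inv_pos.2 (by linarith : (0 : ℝ) < H)]
  have hκ0 : 0 ≤ κ := by linarith
  -- The change of kernel is made twice, for `π` and for the maximizer, each time at cost `(1 + 5/H)
  -- ^ h ≤ e⁵`.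
  have hpow : κ ^ (h : ℕ) * κ ^ (h : ℕ) ≤ Real.exp 10 := by
    have h1 : κ ^ (h : ℕ) ≤ Real.exp 5 := by
      calc κ ^ (h : ℕ) ≤ κ ^ H := pow_le_pow_right₀ hκ1 h.2.le
        _ ≤ Real.exp (5 * (H : ℝ)⁻¹) ^ H := by
            refine pow_le_pow_left₀ hκ0 ?_ _
            rw [hκ, add_comm]
            exact Real.add_one_le_exp _
        _ = Real.exp 5 := by
            rw [← Real.exp_nat_mul]
            congr 1
            field_simp
    calc _ ≤ Real.exp 5 * Real.exp 5 := mul_le_mul h1 h1 (by positivity) (Real.exp_pos _).le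
      _ = Real.exp 10 := by rw [← Real.exp_add]; norm_num
  have hclose := R.extKernel_crude_close hE hι hacc hconc
  have habs := extKernel_absorbing_nonneg M (R.infreq k ω)
  have hval : ∀ σ : Policy S A H, ∀ [Decidable (σ h s = π h s)], valueExt M.init
      (crudeKernel (R.priv2 k ω) (R.priv3 k ω) (infrequent E ι (R.priv3 k ω))) σ
        (indicatorReward h s (π h s)) =
      if σ h s = π h s then occ M.init (extKernel (R.crude k ω) σ) h s else 0 :=
    fun σ _ => valueExt_indicatorReward M.init (R.crude k ω) (crudeKernel_sum _ _ _)
      (fun _ _ _ => rfl) σ h s (π h s)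
  have hmax := (R.pol_argmax k h ω s (π h s)).1 hπ
  simp only [Set.mem_ofPred_eq] at hmax
  set σ := R.pol k h ω s (π h s)
  have : Decidable (π h s = π h s) := isTrue rfl
  rw [hval π, hval σ, if_pos rfl] at hmax
  have h1 := occ_le_pow_mul_occ M.init_nonneg (habs π) hκ0 (fun h u v => (hclose π h u v).2.2)
    (fun h u v => (hclose π h u v).1) h s
  refine h1.trans ?_
  -- If the maximizer does not play the action of `π` at `(h, s)`, the maximal crude value is zero,
  -- which forces the occupancy of `π` to vanish as well.
  split_ifs at hmax ⊢ with hσ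
  · have h2 := occ_le_pow_mul_occ M.init_nonneg (fun h u v => (hclose σ h u v).1) hκ0
      (fun h u v => (hclose σ h u v).2.1) (habs σ) h s
    have h3 := occ_absorbing_le M (R.infreq k ω) σ h s
    calc _ ≤ κ ^ (h : ℕ) * (κ ^ (h : ℕ) * occ M.init (polKernel M.trans σ) h s) := by
          refine mul_le_mul_of_nonneg_left (hmax.trans (h2.trans ?_)) (by positivity)
          exact mul_le_mul_of_nonneg_left h3 (by positivity)
      _ ≤ _ := by
          rw [← mul_assoc]
          exact mul_le_mul_of_nonneg_right hpow (M.occ_nonneg _ _ _)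
  · rw [mul_zero]
    exact mul_nonpos_of_nonneg_of_nonpos (by positivity) hmax

/-- Infrequent transitions are rare under the exploration mixture. -/
theorem mixtureNext_le_of_mem_infreq (R : Run M μ len E ι) {k : Fin K} {ω : Ω} (hE : 1 ≤ E)
    (hι : 1 / 2 ≤ ι) (hacc : R.CountsAccurate ω) (hlen : H ≤ len k)
    {h : Fin H} {s : S} {a : A} {s' : S}
    (hconc : Concentrated M (2 * ι) h s a s' (R.pol k h ω) (R.data k h ω))
    (hF : (h, s, a, s') ∈ R.infreq k ω) :
    mixtureNext M (R.pol k h ω) h s a s' ≤ 40 * (E * (H : ℝ) ^ 3 * ι / len k) := by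
  have hH : (1 : ℝ) ≤ H := by exact_mod_cast h.pos
  have hlen0 : (0 : ℝ) < len k := by exact_mod_cast h.pos.trans_le hlen
  -- Since `H ≤ len k`, rounding down the number of episodes loses at most a factor two.
  have hn : (len k : ℝ) ≤ 2 * H * (len k / H : ℕ) := by
    have h1 : 1 ≤ len k / H := (Nat.one_le_div_iff h.pos).2 hlen
    have h2 := Nat.lt_div_mul_add (a := len k) h.pos
    have h3 : len k ≤ 2 * H * (len k / H) := by nlinarith
    exact_mod_cast h3
  have hc := hconc.mixture
  have h3 := (abs_le.1 ((hacc k h s a).2 s')).1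
  simp only [infreq, infrequent, Set.mem_ofPred_eq] at hF
  set q := mixtureNext M (R.pol k h ω) h s a s'
  have hq : 0 ≤ q := by
    refine Finset.sum_nonneg fun τ _ => mul_nonneg (mixtureProb_nonneg M _ _) ?_
    split_ifs <;> norm_num
  have he : Real.exp (-1) ≤ 1 / 2 := by
    rw [Real.exp_neg, one_div]
    exact inv_anti₀ (by norm_num) (by linarith [Real.add_one_le_exp 1])
  set n : ℝ := ((len k / H : ℕ) : ℝ)
  have hn0 : 0 ≤ n := Nat.cast_nonneg _
  have hnq : 0 ≤ n * q := mul_nonneg hn0 hq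
  have hW : E * ι ≤ E * (H : ℝ) ^ 2 * ι := by
    have : (1 : ℝ) ≤ (H : ℝ) ^ 2 := one_le_pow₀ hH
    have : 0 ≤ E * ι := by positivity
    nlinarith
  -- The tilt `-1` gives `n q / 2 ≤ N + 2ι`, while membership gives `N ≤ 6 E H² ι + E`. With `E ≤ 2
  -- E ι` and `ι ≤ E ι` the total is `12 + 4 + 4 = 20` multiples of `E H² ι`.
  have h1 : n * q ≤ 20 * (E * (H : ℝ) ^ 2 * ι) := by nlinarith
  rw [← mul_div_assoc, le_div_iff₀ hlen0]
  calc q * len k ≤ q * (2 * H * n) := mul_le_mul_of_nonneg_left hn hq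
    _ = 2 * H * (n * q) := by ring
    _ ≤ 2 * H * (20 * (E * (H : ℝ) ^ 2 * ι)) := mul_le_mul_of_nonneg_left h1 (by positivity)
    _ = _ := by ring

theorem value_sub_valueExt_le (R : Run M μ len E ι) {k : Fin K} {ω : Ω} (hE : 1 ≤ E)
    (hι : 1 / 2 ≤ ι) (hacc : R.CountsAccurate ω) (hlen : 1 ≤ len k)
    (hconc : ∀ h s a s', Concentrated M (2 * ι) h s a s' (R.pol k h ω) (R.data k h ω))
    {π : Policy S A H} (hπ : π ∈ R.active k ω) (r : Fin H → S → A → ℝ)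
    (hr : ∀ h s a, 0 ≤ r h s a ∧ r h s a ≤ 1) :
    0 ≤ value M.init M.trans π r - valueExt M.init (R.absorbing k ω) π r ∧
    value M.init M.trans π r - valueExt M.init (R.absorbing k ω) π r ≤
      40 * Real.exp 10 * (E * (Fintype.card S : ℝ) ^ 3 * (Fintype.card A : ℝ) * (H : ℝ) ^ 5 *
        ι / (len k : ℝ)) := by
  classical
  have := M.nonempty_state
  have hS : (1 : ℝ) ≤ Fintype.card S := by exact_mod_cast Fintype.card_pos
  have hA : (1 : ℝ) ≤ Fintype.card A := by exact_mod_cast Fintype.card_pos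
  have hlen0 : (0 : ℝ) < len k := by exact_mod_cast hlen
  set W : ℝ := 40 * (E * (H : ℝ) ^ 3 * ι / len k) with hW
  have hW0 : 0 ≤ W := by positivity
  set B : ℝ := Real.exp 10 * (Fintype.card S * Fintype.card A * W) with hB
  have hB0 : 0 ≤ B := by positivity
  have hfin : (H : ℝ) ^ 2 * (Fintype.card S : ℝ) ^ 2 * B = 40 * Real.exp 10 *
      (E * (Fintype.card S : ℝ) ^ 3 * (Fintype.card A : ℝ) * (H : ℝ) ^ 5 * ι / (len k : ℝ)) := by
    rw [hB, hW]; ring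
  rw [← hfin]
  refine value_sub_valueExt_absorbing M (R.infreq k ω) π r hr hB0 fun h s s' hm => ?_
  have hcov := R.occ_absorbing_le_explore hE hι hacc hconc hπ h s
  have hP := M.trans_nonneg h s (π h s) s'
  by_cases hH : H ≤ len k
  · have hmix := occ_mul_trans_le_mixtureNext M (R.pol k h ω) h s (π h s) s'
    have hrare := R.mixtureNext_le_of_mem_infreq hE hι hacc hH (hconc h s (π h s) s') hm
    calc _ ≤ _ := mul_le_mul_of_nonneg_right hcov hP
      _ = Real.exp 10 * (if R.pol k h ω s (π h s) h s = π h s then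
          occ M.init (polKernel M.trans (R.pol k h ω s (π h s))) h s *
            M.trans h s (π h s) s' else 0) := by split_ifs <;> ring
      _ ≤ Real.exp 10 * (Fintype.card S * Fintype.card A * W) := by
          refine mul_le_mul_of_nonneg_left (hmix.trans ?_) (Real.exp_pos _).le
          exact mul_le_mul_of_nonneg_left hrare (by positivity)
  -- A stage shorter than the horizon has empty batches and no information, but then `W ≥ 1` and the
  -- bound on a probability is trivial.
  · have hHlen : (len k : ℝ) ≤ H := by exact_mod_cast (not_le.1 hH).le
    have hH1 : (1 : ℝ) ≤ H := by exact_mod_cast h.pos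
    have h1 : occ M.init (extKernel (R.absorbing k ω) π) h s ≤ 1 := by
      refine (occ_absorbing_le M (R.infreq k ω) π h s).trans ?_
      rw [← M.sum_occ π h h.2.le]
      exact Finset.single_le_sum (fun u _ => M.occ_nonneg _ _ u) (Finset.mem_univ s)
    have h2 : M.trans h s (π h s) s' ≤ 1 := by
      rw [← M.trans_sum h s (π h s)]
      exact Finset.single_le_sum (fun w _ => M.trans_nonneg _ _ _ w) (Finset.mem_univ s')
    have h3 : 1 ≤ W := by
      rw [hW, ← mul_div_assoc, le_div_iff₀ hlen0]
      have h4 : (H : ℝ) ≤ (H : ℝ) ^ 3 := le_self_pow₀ hH1 (by norm_num)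
      have h5 : 1 / 2 ≤ E * ι := by nlinarith
      have h6 : (1 / 2 : ℝ) * H ≤ E * ι * (H : ℝ) ^ 3 :=
        mul_le_mul h5 h4 (by positivity) (by positivity)
      nlinarith
    have h4 : (1 : ℝ) ≤ Fintype.card S * Fintype.card A :=
      one_le_mul_of_one_le_of_one_le hS hA
    calc _ ≤ (1 : ℝ) := mul_le_one₀ h1 hP h2
      _ ≤ B := one_le_mul_of_one_le_of_one_le (Real.one_le_exp (by norm_num))
          (one_le_mul_of_one_le_of_one_le h4 h3)

end Run

/-! ### The logarithmic factor and the union bound -/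

theorem exp_neg_logFactor {S A : Type*} [Fintype S] [Fintype A] [Nonempty S] [Nonempty A]
    {H T : ℕ} {δ : ℝ} (hH : 0 < H) (hT : 0 < T) (hδ : 0 < δ) :
    Real.exp (-logFactor S A H T δ) =
      δ / (2 * (Fintype.card S : ℝ) * (Fintype.card A : ℝ) * (H : ℝ) * (T : ℝ)) := by
  have hS : (0 : ℝ) < Fintype.card S := by exact_mod_cast Fintype.card_pos
  have hA : (0 : ℝ) < Fintype.card A := by exact_mod_cast Fintype.card_pos
  have hH' : (0 : ℝ) < H := by exact_mod_cast hH
  have hT' : (0 : ℝ) < T := by exact_mod_cast hT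
  rw [logFactor, Real.exp_neg, Real.exp_log (by positivity), inv_div]

theorem half_le_logFactor {S A : Type*} [Fintype S] [Fintype A] [Nonempty S] [Nonempty A]
    {H T : ℕ} {δ : ℝ} (hH : 0 < H) (hT : 0 < T) (hδ : 0 < δ) (hδ1 : δ < 1) :
    1 / 2 ≤ logFactor S A H T δ := by
  have h1 : (1 : ℝ) ≤ Fintype.card S * Fintype.card A * H * T := by
    exact_mod_cast Nat.mul_pos (Nat.mul_pos (Nat.mul_pos Fintype.card_pos Fintype.card_pos) hH) hT
  have h2 : (2 : ℝ) ≤ 2 * (Fintype.card S : ℝ) * (Fintype.card A : ℝ) * (H : ℝ) * (T : ℝ) / δ := by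
    rw [le_div_iff₀ hδ]
    nlinarith
  have h3 : Real.log 2 ≤ logFactor S A H T δ := Real.log_le_log (by norm_num) h2
  linarith [Real.log_two_gt_d9]

/-- The exponent `2ι` rather than `ι` is what absorbs the second factor `S` from the next states:
`(δ / (2SAHT))²` beats `K H S² A` because `K ≤ T`. -/
theorem union_bound_le {S A : Type*} [Fintype S] [Fintype A] [Nonempty S] [Nonempty A]
    {H K T : ℕ} {δ : ℝ} (hKT : K ≤ T) (hδ : 0 < δ) (hδ1 : δ < 1) :
    (K : ℝ) * H * Fintype.card S * Fintype.card A * Fintype.card S *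
      (3 * Real.exp (-(2 * logFactor S A H T δ))) ≤ 4 * δ := by
  rcases Nat.eq_zero_or_pos K with rfl | hK
  · simp [hδ.le]
  rcases Nat.eq_zero_or_pos H with rfl | hH
  · simp [hδ.le]
  have hT := hK.trans_le hKT
  have hS : (0 : ℝ) < Fintype.card S := by exact_mod_cast Fintype.card_pos
  have hA : (1 : ℝ) ≤ Fintype.card A := by exact_mod_cast Fintype.card_pos
  have hH' : (1 : ℝ) ≤ H := by exact_mod_cast hH
  have hT' : (1 : ℝ) ≤ T := by exact_mod_cast hT
  have hK' : (K : ℝ) ≤ T := by exact_mod_cast hKT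
  have he : Real.exp (-(2 * logFactor S A H T δ)) =
      (δ / (2 * (Fintype.card S : ℝ) * (Fintype.card A : ℝ) * (H : ℝ) * (T : ℝ))) ^ 2 := by
    rw [← exp_neg_logFactor hH hT hδ, ← Real.exp_nat_mul]
    congr 1
    push_cast
    ring
  rw [he]
  calc _ = 3 / 4 * δ * (δ * (K / T) * (1 / (H * Fintype.card A * T))) := by
        field_simp
        norm_num
    _ ≤ 3 / 4 * δ * 1 := by
        refine mul_le_mul_of_nonneg_left ?_ (by positivity)
        have h1 : (K : ℝ) / T ≤ 1 := (div_le_one (by linarith)).2 hK'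
        have h2 : 1 / ((H : ℝ) * Fintype.card A * T) ≤ 1 := by
          rw [div_le_one (by positivity)]
          exact one_le_mul_of_one_le_of_one_le (one_le_mul_of_one_le_of_one_le hH' hA) hT'
        exact mul_le_one₀ (mul_le_one₀ hδ1.le (by positivity) h1) (by positivity) h2
    _ ≤ 4 * δ := by linarith

end PrivateRL

theorem mainTheorem1 :
    ∃ C : ℝ, 0 < C ∧
      ∀ {S A Ω : Type*} [Fintype S] [Fintype A] [Nonempty A] [MeasurableSpace Ω]
        (μ : Measure Ω) [IsProbabilityMeasure μ]
        (H K T : ℕ) (len : Fin K → ℕ) (δ E : ℝ)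
        (M : PrivateRL.EpisodicMDP S A H)
        (R : PrivateRL.Run M μ len E (PrivateRL.logFactor S A H T δ)),
        0 < δ → δ < 1 → 1 ≤ E →
        (∀ k, 1 ≤ len k) → ∑ k, len k ≤ T →
        μ {ω | ¬ R.CountsAccurate ω} ≤ ENNReal.ofReal (3 * δ) →
        μ {ω | ¬ ∀ k : Fin K, ∀ π ∈ R.active k ω, ∀ r' : Fin H → S → A → ℝ,
            (∀ h s a, 0 ≤ r' h s a ∧ r' h s a ≤ 1) →
            0 ≤ PrivateRL.value M.init M.trans π r' -
                  PrivateRL.valueExt M.init (R.absorbing k ω) π r' ∧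
            PrivateRL.value M.init M.trans π r' -
                  PrivateRL.valueExt M.init (R.absorbing k ω) π r' ≤
              C * (E * (Fintype.card S : ℝ) ^ 3 * (Fintype.card A : ℝ) * (H : ℝ) ^ 5 *
                PrivateRL.logFactor S A H T δ / (len k : ℝ))} ≤
          ENNReal.ofReal (7 * δ) := by
  refine ⟨40 * Real.exp 10, by positivity, ?_⟩
  intro S A Ω _ _ _ _ μ _ H K T len δ E M R hδ hδ1 hE hlen hsum hacc
  have := M.nonempty_state
  have hKT : K ≤ T := by
    refine le_trans ?_ hsum
    simpa using Finset.sum_le_sum (s := Finset.univ) fun (k : Fin K) _ => hlen k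
  have hconc := R.measure_not_concentrated_le (2 * PrivateRL.logFactor S A H T δ)
  replace hconc := hconc.trans (ENNReal.ofReal_le_ofReal (PrivateRL.union_bound_le hKT hδ hδ1))
  refine (measure_mono (t := {ω | ¬ R.CountsAccurate ω} ∪ {ω | ¬ ∀ k h s a s',
    PrivateRL.Concentrated M (2 * PrivateRL.logFactor S A H T δ) h s a s'
      (R.pol k h ω) (R.data k h ω)}) fun ω hω => ?_).trans ((measure_union_le _ _).trans ?_)
  · by_contra hc
    simp only [Set.mem_union, Set.mem_ofPred_eq, not_or, not_not] at hc hω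
    refine hω fun k π hπ r hr => ?_
    have hT : 0 < T := k.pos.trans_le hKT
    -- For `H = 0` the logarithm has argument zero and takes the default value `0`, so the lower
    -- bound on it fails; but then both values are empty sums.
    rcases Nat.eq_zero_or_pos H with rfl | hH
    · simp [PrivateRL.value, PrivateRL.valueExt]
    · exact R.value_sub_valueExt_le hE (PrivateRL.half_le_logFactor hH hT hδ hδ1) hc.1 (hlen k)
        (hc.2 k) hπ r hr
  · refine (add_le_add hacc hconc).trans_eq ?_
    rw [← ENNReal.ofReal_add (by positivity) (by positivity)]
    congr 1
    ring
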